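/- Notation. Put $\tilde h(k)=(2\pi)^{-1/2}\int_{\mathbb R} e^{-ikx}h(x)\,dx$ and $\langle u,v\rangle=\int_0^\infty \frac{dk}{2k}\,\overline{u(k)}\,v(k)$. Let $\mathcal S(\mathbb R_+)$ be the set of Schwartz functions on $\mathbb R$ that vanish at negative momenta; $u\in\mathcal S(\mathbb R_+)$ is normalized if $\langle u,u\rangle=1$. On the symmetric Fock space over $L^2(\mathbb R_+,\frac{dk}{2k})$, with vacuum $\Omega_o$ and $[a(k),a^\dagger(k')]=2k\,\delta(k-k')$, let $$\phi(x)=\frac1{\sqrt{2\pi}}\int_0^\infty\frac{dk}{2k}\left[a(k)e^{-ikx}+a^\dagger(k)e^{ikx}\right],\qquad \phi[h]=\int_{\mathbb R} h(x)\phi(x)\,dx$$ be the incoming (real, massless, right-moving) field, with $\phi[h]^\dagger=\phi[\bar h]$. Let $x=x(y)$ be a coordinate transformation, i.e. a $C^1$ function $x:\mathbb R\to\mathbb R$ with $x'(y)\neq0$ for all $y$ (not necessarily onto). The outgoing field is $\hat\phi(y)=\phi(x(y))$; that is, $\hat\phi[f]=\phi[\check f]$ with $\check f(x(y))=f(y)/|x'(y)|$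 and $\check f=0$ outside the range of $x(\cdot)$. Let $U$ be the operator with the distribution kernel $U(k,p)=\frac1{2\pi}\int_{\mathbb R} e^{-ikx(y)}e^{ipy}\,dy$, i.e. $(Uu)(k)=\frac1{2\pi}\int_{\mathbb R} dy\,e^{-ikx(y)}\int_{\mathbb R} dp\,e^{ipy}u(p)$, and put $(Au)(k)=\theta(k)(Uu)(k)$, $(Bu)(k)=\theta(k)(Uu)(-k)$. For a state $\Omega$, the mean number of particles with outgoing test function $f$ is $(\Omega,\hat\phi[f]^\dagger\hat\phi[f]\,\Omega)$, understood as the value $\|\hat\phi[f]\Omega\|^2\in[0,\infty]$ of the quadratic form. Write $\bar N_o[f]$ for $\Omega=\Omega_o$ and $\bar N_g[f]$ for the one-particle state $\Omega=\Omega_g=\phi[g]^\dagger\Omega_o$. Theorem. For every coordinate transformation $x(y)$ and all $f,g$ such that $\tilde f,\tilde g\in\mathcal S(\mathbb R_+)$ are normalized, $$\bar N_g[f]=\bar N_o[f]+\left|\langle\tilde g,A\tilde f\rangle\right|^2+\left|\langle\overline{\tilde g},B\tilde f\rangle\right|^2\qquad\text{in }[0,\infty].$$ Moreover, if $\bar N_o[f]<\infty$,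 then $\bar N_o[f]$ and $\bar N_g[f]$ are equal to the literal matrix elements $(\Omega_o,\hat\phi[f]^\dagger\hat\phi[f]\,\Omega_o)$ and $(\Omega_g,\hat\phi[f]^\dagger\hat\phi[f]\,\Omega_g)$. -/

import Mathlib

open MeasureTheory
open scoped ENNReal SchwartzMap ComplexConjugate

noncomputable section

/-! ### Momentum space -/

/-- The invariant measure `dk / (2k)` on the positive momenta `(0, ∞)`, as a measure on `ℝ`. -/
def momMeasure : Measure ℝ :=
  (volume.restrict (Set.Ioi (0 : ℝ))).withDensity fun k => ENNReal.ofReal (1 / (2 * k))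

instance : SigmaFinite momMeasure := by
  unfold momMeasure
  exact SigmaFinite.withDensity (fun k => Real.toNNReal (1 / (2 * k)))

/-- The scalar product `⟨u, v⟩ = ∫₀^∞ dk/(2k) u(k)* v(k)` of wave functions. -/
def momInner (u v : ℝ → ℂ) : ℂ := ∫ k, conj (u k) * v k ∂momMeasure

/-- The Fourier transform `h̃(k) = (2π)^{-1/2} ∫ dx e^{-ikx} h(x)`. -/
def fourierTilde (h : ℝ → ℂ) (k : ℝ) : ℂ :=
  (1 / Real.sqrt (2 * Real.pi) : ℝ) * ∫ x : ℝ, Complex.exp (-(Complex.I * k * x)) * h x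

/-- The function `f` whose Fourier transform is `F`:
`f(y) = (2π)^{-1/2} ∫ dp e^{ipy} F(p)`. -/
def untilde (F : ℝ → ℂ) (y : ℝ) : ℂ :=
  (1 / Real.sqrt (2 * Real.pi) : ℝ) * ∫ p : ℝ, Complex.exp (Complex.I * p * y) * F p

/-- `F ∈ 𝒮(ℝ₊)`: a Schwartz function on `ℝ` that vanishes at negative momenta. -/
def IsPositiveMomentum (F : 𝓢(ℝ, ℂ)) : Prop := ∀ p : ℝ, p < 0 → F p = 0

/-- A normalized wave function: `∫₀^∞ dk/(2k) |F(k)|² = 1`. -/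
def IsNormalized (F : 𝓢(ℝ, ℂ)) : Prop := momInner F F = 1

/-! ### The incoming Fock space

A vector of the symmetric Fock space over `L²(ℝ₊, dk/(2k))` is represented by the sequence of its
`n`-particle wave functions `ψₙ(k₁, …, kₙ)`, which are symmetric. -/

/-- Sequences `(ψₙ)ₙ` of `n`-particle momentum-space wave functions. -/
abbrev FockWave : Type := (n : ℕ) → (Fin n → ℝ) → ℂ

/-- The measure `∏ dkᵢ/(2kᵢ)` on `n`-particle momenta. -/
def momMeasurePi (n : ℕ) : Measure (Fin n → ℝ) := Measure.pi fun _ => momMeasure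

/-- The squared Fock norm `∑ₙ ∫ |ψₙ|² ∏ dkᵢ/(2kᵢ)`, equal to `∞` when the sequence does not
represent a vector of the Fock space. -/
def fockNormSq (ψ : FockWave) : ℝ≥0∞ := ∑' n, ∫⁻ k, ‖ψ n k‖ₑ ^ 2 ∂(momMeasurePi n)

/-- The Fock scalar product `∑ₙ ∫ ψₙ* χₙ ∏ dkᵢ/(2kᵢ)`. -/
def fockInner (ψ χ : FockWave) : ℂ := ∑' n, ∫ k, conj (ψ n k) * χ n k ∂(momMeasurePi n)

/-- The vacuum `Ω₀`. -/
def fockVacuum : FockWave := fun n _ => if n = 0 then 1 else 0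

/-- `∫₀^∞ dk/(2k) v(k) a(k)`, where `[a(k), a†(k')] = 2k δ(k - k')`:
`(a ψ)ₙ(k₁,…,kₙ) = √(n+1) ∫₀^∞ dk/(2k) v(k) ψₙ₊₁(k, k₁,…,kₙ)`. -/
def annihilate (v : ℝ → ℂ) (ψ : FockWave) : FockWave := fun n k =>
  (Real.sqrt (n + 1) : ℂ) * ∫ q, v q * ψ (n + 1) (Fin.cons q k) ∂momMeasure

/-- `∫₀^∞ dk/(2k) u(k) a†(k)`:
`(a† ψ)ₙ(k₁,…,kₙ) = n^{-1/2} ∑ⱼ u(kⱼ) ψₙ₋₁(k₁,…,k̸ⱼ,…,kₙ)`, and `(a† ψ)₀ = 0`. -/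
def create (u : ℝ → ℂ) (ψ : FockWave) : FockWave := fun n =>
  match n with
  | 0 => fun _ => 0
  | m + 1 => fun k =>
      (1 / Real.sqrt (m + 1) : ℝ) * ∑ j : Fin (m + 1), u (k j) * ψ m (fun i => k (j.succAbove i))

/-- The incoming real (hermitian) right-moving field smeared with `h`,
`φ[h] = ∫ dx h(x) φ(x)`, where
`φ(x) = (2π)^{-1/2} ∫₀^∞ dk/(2k) [a(k) e^{-ikx} + a†(k) e^{ikx}]`. -/
def inField (h : ℝ → ℂ) (ψ : FockWave) : FockWave := fun n k =>
  annihilate (fun q => fourierTilde h q) ψ n k + create (fun q => fourierTilde h (-q)) ψ n k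

/-- `φ[h]† = ∫ dx h(x)* φ(x)† = φ[h*]`, since `φ(x)† = φ(x)`. -/
def inFieldDagger (h : ℝ → ℂ) (ψ : FockWave) : FockWave := inField (fun x => conj (h x)) ψ

/-- The one-particle state `Ω_g = φ[g]† Ω₀`. -/
def oneParticle (g : ℝ → ℂ) : FockWave := inFieldDagger g fockVacuum

/-! ### The outgoing field -/

/-- The incoming test function `f̌` of an outgoing test function `f` under the coordinate
transformation `x = X(y)`: `f̌(X(y)) = f(y) / |X'(y)|`, and `f̌ = 0` outside the range of `X`.
It is determined by `∫ dx f̌(x) φ(x) = ∫ dy f(y) φ(X(y))`. -/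
def inTest (X : ℝ → ℝ) (f : ℝ → ℂ) : ℝ → ℂ :=
  Function.extend X (fun y => f y / (|deriv X y| : ℝ)) 0

/-- The outgoing field `φ̂[f] = φ[f̌]`, that is `φ̂(y) = φ(X(y))`. -/
def outField (X : ℝ → ℝ) (f : ℝ → ℂ) (ψ : FockWave) : FockWave := inField (inTest X f) ψ

/-- `φ̂[f]† = φ[f̌]†`. -/
def outFieldDagger (X : ℝ → ℝ) (f : ℝ → ℂ) (ψ : FockWave) : FockWave :=
  inFieldDagger (inTest X f) ψ

/-- The mean number of particles with outgoing test function `f` in the incoming state `Ψ`, as an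
element of `[0, ∞]`: the value `‖φ̂[f] Ψ‖²` at `Ψ` of the quadratic form of `φ̂[f]† φ̂[f]`. -/
def meanNumber (X : ℝ → ℝ) (f : ℝ → ℂ) (Ψ : FockWave) : ℝ≥0∞ := fockNormSq (outField X f Ψ)

/-- The matrix element `(Ψ, φ̂[f]† φ̂[f] Ψ)`. -/
def numberElement (X : ℝ → ℝ) (f : ℝ → ℂ) (Ψ : FockWave) : ℂ :=
  fockInner Ψ (outFieldDagger X f (outField X f Ψ))

/-! ### The Bogoliubov operator -/

/-- The operator `U` with distribution kernel `U(k,p) = (2π)⁻¹ ∫ dy e^{-ikX(y)} e^{ipy}`. As usual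
for such a kernel, the integral over `p` against the test function is carried out first. -/
def bogU (X : ℝ → ℝ) (F : ℝ → ℂ) (k : ℝ) : ℂ :=
  (1 / (2 * Real.pi) : ℝ) *
    ∫ y : ℝ, Complex.exp (-(Complex.I * k * X y)) * ∫ p : ℝ, Complex.exp (Complex.I * p * y) * F p

/-- `(A F)(k) = θ(k) (U F)(k)`. -/
def bogA (X : ℝ → ℝ) (F : ℝ → ℂ) (k : ℝ) : ℂ := if 0 < k then bogU X F k else 0

/-- `(B F)(k) = θ(k) (U F)(-k)`. -/
def bogB (X : ℝ → ℝ) (F : ℝ → ℂ) (k : ℝ) : ℂ := if 0 < k then bogU X F (-k) else 0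

end

/-! ### Symmetrised products of two wave functions -/

section TwoParticle

variable {α : Type*} [MeasurableSpace α] {μ : Measure α} {u w : α → ℂ}

/-! Substituting `x = X y` shows that the Fourier transform of the incoming test function is `bogU X
F` (`fourierTilde_inTest_untilde`). The outgoing field therefore annihilates with `bogU X F q` and
creates with `u q = bogU X F (-q)`. On the vacuum it yields the one-particle vector `u`, of squared
norm `∫ |u|²`.

The state `Ω_g` has the single wave function `w = conj G`. The field maps it to a vacuum component,
the pairing of `G` with `bogA X F`, plus the symmetrised two-particle function `(u ⊗ w + w ⊗ u) /
√2`. For `‖w‖ = 1` the latter has squared norm `‖u‖² + |⟨w, u⟩|²` (`lintegral_enorm_symmetrized`),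
also when `‖u‖ = ∞`; here `⟨w, u⟩` is the `bogB` term.

When `‖u‖ < ∞`, the one-particle component of `φ̂† φ̂ Ω_g` is computed explicitly and paired with
`w`. The point needing care there is convergence of each integral. -/

theorem lintegral_enorm_sq_eq_ofReal {β : Type*} [MeasurableSpace β] {ν : Measure β}
    {v : β → ℂ} (hv : MemLp v 2 ν) :
    ∫⁻ q, ‖v q‖ₑ ^ 2 ∂ν = ENNReal.ofReal (∫ q, ‖v q‖ ^ 2 ∂ν) := by
  rw [ofReal_integral_eq_lintegral_ofReal (hv.integrable_norm_pow (p := 2) (by norm_num))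
    (Filter.Eventually.of_forall fun q => by positivity)]
  refine lintegral_congr fun q => ?_
  rw [ENNReal.ofReal_pow (norm_nonneg _), ofReal_norm]

theorem memLp_two_of_lintegral_ne_top (hu : AEStronglyMeasurable u μ)
    (h : ∫⁻ q, ‖u q‖ₑ ^ 2 ∂μ ≠ ∞) : MemLp u 2 μ := by
  refine ⟨hu, ?_⟩
  rw [eLpNorm_lt_top_iff_lintegral_rpow_enorm_lt_top (by norm_num) (by norm_num)]
  simpa using h.lt_top

theorem integral_conj_mul_self (u : α → ℂ) :
    ∫ q, conj (u q) * u q ∂μ = ((∫ q, ‖u q‖ ^ 2 ∂μ : ℝ) : ℂ) := by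
  rw [← integral_complex_ofReal]
  refine integral_congr_ae (Filter.Eventually.of_forall fun q => ?_)
  simp [Complex.conj_mul']

theorem MeasureTheory.MemLp.integrable_conj_mul (hw : MemLp w 2 μ) (hu : MemLp u 2 μ) :
    Integrable (fun q => conj (w q) * u q) μ :=
  hw.star.integrable_mul hu

/-- Expanding the square leaves a cross term that is the real part of a product of one function of
`p.1` and one of `p.2`. Fubini turns it into `⟨w, u⟩` times its conjugate. -/
theorem lintegral_enorm_symmetrized_of_memLp [SFinite μ] (hu : MemLp u 2 μ) (hw : MemLp w 2 μ)
    (h1 : ∫ q, ‖w q‖ ^ 2 ∂μ = 1) :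
    ∫⁻ p, ‖((1 / √2 : ℝ) : ℂ) * (u p.1 * w p.2 + u p.2 * w p.1)‖ₑ ^ 2 ∂(μ.prod μ) =
      ∫⁻ q, ‖u q‖ₑ ^ 2 ∂μ + ENNReal.ofReal (‖∫ q, conj (w q) * u q ∂μ‖ ^ 2) := by
  have hI := hw.integrable_conj_mul hu
  have hJ := hu.integrable_conj_mul hw
  have hu2 := hu.integrable_norm_pow (p := 2) (by norm_num)
  have hw2 := hw.integrable_norm_pow (p := 2) (by norm_num)
  have hpt : ∀ p : α × α, ‖((1 / √2 : ℝ) : ℂ) * (u p.1 * w p.2 + u p.2 * w p.1)‖ ^ 2 =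
      (1 / 2) * (‖u p.1‖ ^ 2 * ‖w p.2‖ ^ 2 + ‖w p.1‖ ^ 2 * ‖u p.2‖ ^ 2)
        + (conj (w p.1) * u p.1 * (conj (u p.2) * w p.2)).re := by
    intro p
    rw [norm_mul, mul_pow, Complex.norm_real, Real.norm_eq_abs, sq_abs, div_pow,
      Real.sq_sqrt (by norm_num), ← Complex.normSq_eq_norm_sq, Complex.normSq_add,
      Complex.normSq_eq_norm_sq, Complex.normSq_eq_norm_sq, norm_mul, norm_mul, mul_pow, mul_pow,
      map_mul,
      show u p.1 * w p.2 * (conj (u p.2) * conj (w p.1)) =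
        conj (w p.1) * u p.1 * (conj (u p.2) * w p.2) by ring]
    ring
  have hint1 : Integrable (fun p : α × α => (1 / 2 : ℝ) *
      (‖u p.1‖ ^ 2 * ‖w p.2‖ ^ 2 + ‖w p.1‖ ^ 2 * ‖u p.2‖ ^ 2)) (μ.prod μ) :=
    ((hu2.mul_prod hw2).add (hw2.mul_prod hu2)).const_mul _
  have hint2 : Integrable (fun p : α × α => conj (w p.1) * u p.1 * (conj (u p.2) * w p.2))
      (μ.prod μ) := hI.mul_prod hJ
  have hc : ∫ q, conj (u q) * w q ∂μ = conj (∫ q, conj (w q) * u q ∂μ) := by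
    rw [← integral_conj]
    exact integral_congr_ae (Filter.Eventually.of_forall fun q => by simp [mul_comm])
  have key : ∫ p, ‖((1 / √2 : ℝ) : ℂ) * (u p.1 * w p.2 + u p.2 * w p.1)‖ ^ 2 ∂(μ.prod μ) =
      ∫ q, ‖u q‖ ^ 2 ∂μ + ‖∫ q, conj (w q) * u q ∂μ‖ ^ 2 := by
    simp_rw [hpt]
    refine (integral_add hint1 hint2.re).trans ?_
    rw [integral_const_mul,
      integral_add (hu2.mul_prod hw2) (hw2.mul_prod hu2),
      integral_prod_mul (fun q => ‖u q‖ ^ 2) (fun q => ‖w q‖ ^ 2),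
      integral_prod_mul (fun q => ‖w q‖ ^ 2) (fun q => ‖u q‖ ^ 2), h1]
    have := integral_re hint2
    rw [this, RCLike.re_to_complex, integral_prod_mul (fun q => conj (w q) * u q) (fun q => conj (u q) * w q), hc,
      Complex.mul_conj, Complex.ofReal_re, Complex.normSq_eq_norm_sq]
    ring
  have hint : Integrable
      (fun p : α × α => ‖((1 / √2 : ℝ) : ℂ) * (u p.1 * w p.2 + u p.2 * w p.1)‖ ^ 2)
      (μ.prod μ) := by
    simp_rw [hpt]
    exact hint1.add hint2.re
  rw [lintegral_enorm_sq_eq_ofReal hu, ← ENNReal.ofReal_add (by positivity) (by positivity), ← key,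
    ofReal_integral_eq_lintegral_ofReal hint (Filter.Eventually.of_forall fun q => by positivity)]
  refine lintegral_congr fun q => ?_
  rw [ENNReal.ofReal_pow (norm_nonneg _), ofReal_norm]

/-- Were the integral finite, almost every slice in `q` would be square integrable. Where `w q ≠ 0`,
subtracting the square integrable `u q * w r` would make `u` square integrable; so `w` would vanish
almost everywhere. -/
theorem lintegral_enorm_symmetrized_eq_top [SFinite μ] (hu : Measurable u) (hw : Measurable w)
    (hw2 : ∫⁻ q, ‖w q‖ₑ ^ 2 ∂μ ≠ ∞) (hw0 : ∫⁻ q, ‖w q‖ₑ ^ 2 ∂μ ≠ 0)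
    (h : ∫⁻ q, ‖u q‖ₑ ^ 2 ∂μ = ∞) :
    ∫⁻ p, ‖((1 / √2 : ℝ) : ℂ) * (u p.1 * w p.2 + u p.2 * w p.1)‖ₑ ^ 2 ∂(μ.prod μ) = ∞ := by
  have hm : Measurable fun p : α × α =>
      ‖((1 / √2 : ℝ) : ℂ) * (u p.1 * w p.2 + u p.2 * w p.1)‖ₑ ^ 2 := by fun_prop
  rw [lintegral_prod _ hm.aemeasurable]
  by_contra htop
  have hae := ae_lt_top hm.lintegral_prod_right' htop
  refine hw0 ((lintegral_eq_zero_iff (by fun_prop)).2 ?_)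
  filter_upwards [hae] with q hq
  by_contra hne
  have hwq : w q ≠ 0 := by
    intro h0
    exact hne (by simp [h0])
  -- From `|b|² ≤ 2|a + b|² + 2|a|²`; the factor `1/√2` inside the norm turns the first 2 into 4.
  have hb : ∀ r, ‖w q‖ₑ ^ 2 * ‖u r‖ₑ ^ 2 ≤
      4 * ‖((1 / √2 : ℝ) : ℂ) * (u q * w r + u r * w q)‖ₑ ^ 2 + 2 * ‖u q‖ₑ ^ 2 * ‖w r‖ₑ ^ 2 := by
    intro r
    have hreal : ‖w q‖ ^ 2 * ‖u r‖ ^ 2 ≤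
        4 * ‖((1 / √2 : ℝ) : ℂ) * (u q * w r + u r * w q)‖ ^ 2 + 2 * ‖u q‖ ^ 2 * ‖w r‖ ^ 2 := by
      rw [norm_mul, mul_pow, Complex.norm_real, Real.norm_eq_abs, sq_abs, div_pow,
        Real.sq_sqrt (by norm_num)]
      have h1 : ‖u r * w q‖ ≤ ‖u q * w r + u r * w q‖ + ‖u q * w r‖ := by
        simpa using norm_sub_le (u q * w r + u r * w q) (u q * w r)
      have h2 : ‖u r * w q‖ ^ 2 ≤ (‖u q * w r + u r * w q‖ + ‖u q * w r‖) ^ 2 := by gcongr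
      have h3 : ‖u r * w q‖ ^ 2 = ‖w q‖ ^ 2 * ‖u r‖ ^ 2 := by rw [norm_mul]; ring
      have h4 : ‖u q * w r‖ ^ 2 = ‖u q‖ ^ 2 * ‖w r‖ ^ 2 := by rw [norm_mul]; ring
      nlinarith [sq_nonneg (‖u q * w r + u r * w q‖ - ‖u q * w r‖)]
    have := ENNReal.ofReal_le_ofReal hreal
    rwa [ENNReal.ofReal_add (by positivity) (by positivity), ENNReal.ofReal_mul (by positivity),
      ENNReal.ofReal_mul (by positivity), ENNReal.ofReal_mul (by positivity),
      ENNReal.ofReal_mul (by positivity), ENNReal.ofReal_pow (norm_nonneg _),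
      ENNReal.ofReal_pow (norm_nonneg _), ENNReal.ofReal_pow (norm_nonneg _),
      ENNReal.ofReal_pow (norm_nonneg _), ENNReal.ofReal_pow (norm_nonneg _), ofReal_norm,
      ofReal_norm, ofReal_norm, ofReal_norm, ofReal_norm, ENNReal.ofReal_ofNat,
      ENNReal.ofReal_ofNat] at this
  have hle := lintegral_mono (μ := μ) hb
  rw [lintegral_const_mul _ (by fun_prop), h, ENNReal.mul_top (by simpa using hwq),
    lintegral_add_right _ (by fun_prop), lintegral_const_mul _ (by fun_prop),
    lintegral_const_mul _ (by fun_prop), top_le_iff] at hle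
  refine ENNReal.add_ne_top.2 ⟨ENNReal.mul_ne_top (by norm_num) hq.ne, ENNReal.mul_ne_top ?_ hw2⟩ hle
  exact ENNReal.mul_ne_top (by norm_num) (by simp)

theorem lintegral_enorm_symmetrized [SFinite μ] (hu : Measurable u) (hw : Measurable w)
    (hw2 : MemLp w 2 μ) (h1 : ∫ q, ‖w q‖ ^ 2 ∂μ = 1) :
    ∫⁻ p, ‖((1 / √2 : ℝ) : ℂ) * (u p.1 * w p.2 + u p.2 * w p.1)‖ₑ ^ 2 ∂(μ.prod μ) =
      ∫⁻ q, ‖u q‖ₑ ^ 2 ∂μ + ENNReal.ofReal (‖∫ q, conj (w q) * u q ∂μ‖ ^ 2) := by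
  by_cases h : ∫⁻ q, ‖u q‖ₑ ^ 2 ∂μ = ∞
  · have hw1 : ∫⁻ q, ‖w q‖ₑ ^ 2 ∂μ = 1 := by
      rw [lintegral_enorm_sq_eq_ofReal hw2, h1, ENNReal.ofReal_one]
    rw [lintegral_enorm_symmetrized_eq_top hu hw (by simp [hw1]) (by simp [hw1]) h, h, top_add]
  · exact lintegral_enorm_symmetrized_of_memLp
      (memLp_two_of_lintegral_ne_top hu.aestronglyMeasurable h) hw2 h1

end TwoParticle

/-! ### One-particle states and the action of the field on them -/

/-- The Fock vector whose only nonzero component is the one-particle wave function `w`. -/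
def singleParticle (w : ℝ → ℂ) : FockWave := fun n k =>
  match n, k with
  | 1, k => w (k 0)
  | _, _ => 0

theorem inField_fockVacuum (h : ℝ → ℂ) :
    inField h fockVacuum = singleParticle fun q => fourierTilde h (-q) := by
  funext n k
  rcases n with _ | _ | n <;> simp [inField, annihilate, create, fockVacuum, singleParticle]

theorem inField_singleParticle_zero (h w : ℝ → ℂ) (k : Fin 0 → ℝ) :
    inField h (singleParticle w) 0 k = ∫ q, fourierTilde h q * w q ∂momMeasure := by
  simp [inField, annihilate, create, singleParticle]

theorem inField_singleParticle_one (h w : ℝ → ℂ) (k : Fin 1 → ℝ) :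
    inField h (singleParticle w) 1 k = 0 := by
  simp [inField, annihilate, create, singleParticle]

theorem inField_singleParticle_two (h w : ℝ → ℂ) (k : Fin 2 → ℝ) :
    inField h (singleParticle w) 2 k = ((1 / √2 : ℝ) : ℂ) *
      (fourierTilde h (-k 0) * w (k 1) + fourierTilde h (-k 1) * w (k 0)) := by
  simp [inField, annihilate, create, singleParticle, Fin.sum_univ_two, one_add_one_eq_two]

theorem inField_singleParticle_add_three (h w : ℝ → ℂ) (n : ℕ) (k : Fin (n + 3) → ℝ) :
    inField h (singleParticle w) (n + 3) k = 0 := by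
  simp [inField, annihilate, create, singleParticle]

theorem lintegral_momMeasurePi_zero (f : (Fin 0 → ℝ) → ℝ≥0∞) :
    ∫⁻ k, f k ∂(momMeasurePi 0) = f default := by
  rw [momMeasurePi, Measure.pi_of_empty _ default]; simp

theorem integral_momMeasurePi_zero (f : (Fin 0 → ℝ) → ℂ) :
    ∫ k, f k ∂(momMeasurePi 0) = f default := by
  rw [momMeasurePi, Measure.pi_of_empty _ default]; simp

theorem lintegral_momMeasurePi_one (f : ℝ → ℝ≥0∞) :
    ∫⁻ k, f (k 0) ∂(momMeasurePi 1) = ∫⁻ q, f q ∂momMeasure :=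
  (measurePreserving_funUnique momMeasure (Fin 1)).lintegral_comp_emb
    (MeasurableEquiv.measurableEmbedding _) f

theorem integral_momMeasurePi_one (f : ℝ → ℂ) :
    ∫ k, f (k 0) ∂(momMeasurePi 1) = ∫ q, f q ∂momMeasure :=
  (measurePreserving_funUnique momMeasure (Fin 1)).integral_comp
    (MeasurableEquiv.measurableEmbedding _) f

theorem lintegral_momMeasurePi_two (f : ℝ × ℝ → ℝ≥0∞) :
    ∫⁻ k, f (k 0, k 1) ∂(momMeasurePi 2) = ∫⁻ p, f p ∂(momMeasure.prod momMeasure) :=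
  (measurePreserving_finTwoArrow momMeasure).lintegral_comp_emb
    (MeasurableEquiv.measurableEmbedding _) f

theorem fockNormSq_singleParticle (w : ℝ → ℂ) :
    fockNormSq (singleParticle w) = ∫⁻ q, ‖w q‖ₑ ^ 2 ∂momMeasure := by
  rw [fockNormSq, tsum_eq_single 1]
  · exact lintegral_momMeasurePi_one fun q => ‖w q‖ₑ ^ 2
  · intro n hn
    rcases n with _ | _ | n <;> simp_all [singleParticle]

theorem fockNormSq_inField_singleParticle (h w : ℝ → ℂ) :
    fockNormSq (inField h (singleParticle w)) =
      ENNReal.ofReal (‖∫ q, fourierTilde h q * w q ∂momMeasure‖ ^ 2) +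
      ∫⁻ p, ‖((1 / √2 : ℝ) : ℂ) * (fourierTilde h (-p.1) * w p.2 +
        fourierTilde h (-p.2) * w p.1)‖ₑ ^ 2 ∂(momMeasure.prod momMeasure) := by
  have h3 : ∀ n ∉ Finset.range 3,
      ∫⁻ k, ‖inField h (singleParticle w) n k‖ₑ ^ 2 ∂(momMeasurePi n) = 0 := by
    intro n hn
    obtain ⟨m, rfl⟩ := Nat.exists_eq_add_of_le' (by simpa using hn : 3 ≤ n)
    simp [inField_singleParticle_add_three]
  rw [fockNormSq, tsum_eq_sum h3, Finset.sum_range_succ, Finset.sum_range_succ, Finset.sum_range_one, lintegral_momMeasurePi_zero]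
  simp_rw [inField_singleParticle_zero, inField_singleParticle_one, inField_singleParticle_two]
  rw [lintegral_momMeasurePi_two fun p => ‖((1 / √2 : ℝ) : ℂ) * (fourierTilde h (-p.1) * w p.2 +
        fourierTilde h (-p.2) * w p.1)‖ₑ ^ 2]
  simp [ENNReal.ofReal_pow]

theorem fockInner_fockVacuum (ψ : FockWave) : fockInner fockVacuum ψ = ψ 0 default := by
  rw [fockInner, tsum_eq_single 0]
  · rw [integral_momMeasurePi_zero]; simp [fockVacuum]
  · intro n hn
    simp [fockVacuum, hn]

theorem fockInner_singleParticle (w : ℝ → ℂ) (ψ : FockWave) :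
    fockInner (singleParticle w) ψ =
      ∫ q, conj (w q) * ψ 1 (fun _ => q) ∂momMeasure := by
  rw [fockInner, tsum_eq_single 1]
  · rw [← integral_momMeasurePi_one]
    refine integral_congr_ae (Filter.Eventually.of_forall fun k => ?_)
    have : (fun _ => k 0) = k := by
      funext i; rw [Subsingleton.elim i 0]
    simp [singleParticle, this]
  · intro n hn
    rcases n with _ | _ | n <;> simp_all [singleParticle]

theorem fourierTilde_conj (h : ℝ → ℂ) (k : ℝ) :
    fourierTilde (fun x => conj (h x)) k = conj (fourierTilde h (-k)) := by
  simp only [fourierTilde, map_mul, Complex.conj_ofReal, ← integral_conj]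
  congr 2
  funext x
  simp [← Complex.exp_conj]

/-- The one-particle component of `φ[h]† φ[h]` on a one-particle state. -/
theorem inFieldDagger_inField_singleParticle_one (h w : ℝ → ℂ) (q : ℝ) :
    inFieldDagger h (inField h (singleParticle w)) 1 (fun _ => q) =
      (∫ r, conj (fourierTilde h (-r)) *
          (fourierTilde h (-r) * w q + fourierTilde h (-q) * w r) ∂momMeasure)
        + conj (fourierTilde h q) * ∫ r, fourierTilde h r * w r ∂momMeasure := by
  -- The `√2` from annihilating one of two particles cancels the `1/√2` of the symmetrised product.
  have hs : ((√2 : ℝ) : ℂ) * ((1 / √2 : ℝ) : ℂ) = 1 := by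
    rw [← Complex.ofReal_mul, mul_one_div_cancel (by positivity), Complex.ofReal_one]
  rw [inFieldDagger, inField, annihilate, create]
  simp only [fourierTilde_conj, inField_singleParticle_zero]
  congr 1
  · rw [← integral_const_mul]
    refine integral_congr_ae (Filter.Eventually.of_forall fun r => ?_)
    simp only [Nat.cast_one, one_add_one_eq_two]
    change _ * (_ * inField h (singleParticle w) 2 (Fin.cons r fun _ => q)) = _
    rw [inField_singleParticle_two]
    change _ * (_ * (_ * (fourierTilde h (-r) * w q + fourierTilde h (-q) * w r))) = _
    linear_combination (conj (fourierTilde h (-r)) *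
      (fourierTilde h (-r) * w q + fourierTilde h (-q) * w r)) * hs
  · simp

/-! ### Fourier transforms of the test functions -/

theorem untilde_eq_fourierInv (G : 𝓢(ℝ, ℂ)) (y : ℝ) :
    untilde G y =
      (1 / √(2 * Real.pi) : ℝ) * (FourierTransform.fourierInv G : 𝓢(ℝ, ℂ)) (y / (2 * Real.pi)) := by
  rw [SchwartzMap.fourierInv_coe, Real.fourierInv_eq', untilde]
  congr 1
  refine integral_congr_ae (Filter.Eventually.of_forall fun p => ?_)
  simp only [smul_eq_mul, RCLike.inner_apply, conj_trivial]
  congr 2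
  push_cast
  field_simp

theorem integrable_untilde (G : 𝓢(ℝ, ℂ)) : Integrable (untilde G) := by
  have : untilde G = fun y => _ := funext (untilde_eq_fourierInv G)
  rw [this]
  exact (((FourierTransform.fourierInv G : 𝓢(ℝ, ℂ)).integrable (μ := volume)).comp_div
    (by positivity)).const_mul _

theorem fourierTilde_untilde (G : 𝓢(ℝ, ℂ)) (k : ℝ) : fourierTilde (untilde G) k = G k := by
  have hpi : (0 : ℝ) < 2 * Real.pi := by positivity
  set g : 𝓢(ℝ, ℂ) := FourierTransform.fourierInv G with hg
  have hgG : FourierTransform.fourier g = G := FourierTransform.fourier_fourierInv_eq G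
  -- The two normalisations `(2π)^{-1/2}` cancel the Jacobian of `y = 2πz`, the rescaling to the
  -- convention with `2π` in the exponent.
  have h2 : ((1 / √(2 * Real.pi) : ℝ) : ℂ) * ((1 / √(2 * Real.pi) : ℝ) : ℂ) * (2 * Real.pi : ℝ)
      = 1 := by
    rw [← Complex.ofReal_mul, ← Complex.ofReal_mul, div_mul_div_comm, Real.mul_self_sqrt hpi.le]
    rw [one_mul, one_div_mul_cancel hpi.ne', Complex.ofReal_one]
  have h3 : ∫ y : ℝ, Complex.exp (-(Complex.I * k * y)) * g (y / (2 * Real.pi)) =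
      (2 * Real.pi : ℝ) * G k := by
    have := Measure.integral_comp_div
      (fun z : ℝ => Complex.exp (-(Complex.I * k * ((2 * Real.pi : ℝ) * z))) * g z) (2 * Real.pi)
    rw [abs_of_pos hpi] at this
    have e : ∫ z : ℝ, Complex.exp (-(Complex.I * k * ((2 * Real.pi : ℝ) * z))) * g z = G k := by
      rw [← hgG, SchwartzMap.fourier_coe, Real.fourier_eq']
      refine integral_congr_ae (Filter.Eventually.of_forall fun p => ?_)
      simp only [smul_eq_mul, RCLike.inner_apply, conj_trivial]
      congr 2
      push_cast
      ring
    rw [e, Complex.real_smul] at this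
    rw [← this]
    refine integral_congr_ae (Filter.Eventually.of_forall fun p => ?_)
    simp only
    congr 4
    push_cast
    field_simp
  rw [fourierTilde]
  simp_rw [untilde_eq_fourierInv, ← hg, mul_left_comm (Complex.exp _)]
  rw [integral_const_mul, h3]
  linear_combination G k * h2

/-! ### The transformed test function and the Bogoliubov operator -/

section CoordinateChange

variable {X : ℝ → ℝ}

/-- Rolle's theorem. -/
theorem injective_of_deriv_ne_zero (hX : Continuous X) (hX' : ∀ y, deriv X y ≠ 0) :
    Function.Injective X := by
  have key : ∀ a b, a < b → X a ≠ X b := fun a b hab h =>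
    let ⟨c, _, hc⟩ := exists_deriv_eq_zero hab hX.continuousOn h
    hX' c hc
  intro a b h
  rcases lt_trichotomy a b with hab | hab | hab
  · exact (key a b hab h).elim
  · exact hab
  · exact (key b a hab h.symm).elim

/-- The factor `1/|X'|` cancels the Jacobian, and extension by zero removes the complement of the
range, so `X` need not be onto. -/
theorem integral_mul_inTest (hX : Differentiable ℝ X) (hX' : ∀ y, deriv X y ≠ 0) (f e : ℝ → ℂ) :
    ∫ x, e x * inTest X f x = ∫ y, e (X y) * f y := by
  have hinj := injective_of_deriv_ne_zero hX.continuous hX'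
  have h0 : ∀ x ∉ X '' Set.univ, e x * inTest X f x = 0 := by
    intro x hx
    rw [inTest, Function.extend_apply' _ _ _ (by simpa using hx)]
    simp
  rw [← setIntegral_eq_integral_of_forall_compl_eq_zero h0,
    integral_image_eq_integral_abs_deriv_smul MeasurableSet.univ
      (fun y _ => (hX y).hasDerivAt.hasDerivWithinAt) hinj.injOn, setIntegral_univ]
  refine integral_congr_ae (Filter.Eventually.of_forall fun y => ?_)
  have : ((|deriv X y| : ℝ) : ℂ) ≠ 0 := by simpa using hX' y
  simp only [inTest, hinj.extend_apply, Complex.real_smul]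
  field_simp

theorem fourierTilde_inTest_untilde (hX : Differentiable ℝ X) (hX' : ∀ y, deriv X y ≠ 0)
    (F : ℝ → ℂ) (k : ℝ) : fourierTilde (inTest X (untilde F)) k = bogU X F k := by
  rw [fourierTilde, integral_mul_inTest hX hX' (untilde F)
    (fun x => Complex.exp (-(Complex.I * k * x))), bogU]
  simp only [untilde, mul_left_comm (Complex.exp _)]
  rw [integral_const_mul, ← mul_assoc, ← Complex.ofReal_mul, div_mul_div_comm,
    Real.mul_self_sqrt (by positivity), one_mul]

theorem bogU_eq_integral_untilde (X : ℝ → ℝ) (F : ℝ → ℂ) (k : ℝ) :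
    bogU X F k = (1 / √(2 * Real.pi) : ℝ) *
      ∫ y : ℝ, Complex.exp (-(Complex.I * k * X y)) * untilde F y := by
  rw [bogU]
  simp only [untilde, mul_left_comm (Complex.exp _)]
  rw [integral_const_mul, ← mul_assoc, ← Complex.ofReal_mul, div_mul_div_comm,
    Real.mul_self_sqrt (by positivity), one_mul]

theorem norm_exp_neg_I_mul_mul (k x : ℝ) : ‖Complex.exp (-(Complex.I * k * x))‖ = 1 := by
  rw [show -(Complex.I * k * x) = ((-(k * x) : ℝ) : ℂ) * Complex.I by push_cast; ring,
    Complex.norm_exp_ofReal_mul_I]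

theorem continuous_bogU (hX : Continuous X) (F : 𝓢(ℝ, ℂ)) : Continuous (bogU X F) := by
  have : bogU X F = fun k => _ := funext (bogU_eq_integral_untilde X F)
  rw [this]
  refine continuous_const.mul (continuous_of_dominated (bound := fun y => ‖untilde F y‖)
    (fun k => ?_) (fun k => ?_) (integrable_untilde F).norm ?_)
  · exact (Continuous.aestronglyMeasurable (by fun_prop)).mul
      (integrable_untilde F).aestronglyMeasurable
  · exact Filter.Eventually.of_forall fun y => by rw [norm_mul, norm_exp_neg_I_mul_mul, one_mul]
  · exact Filter.Eventually.of_forall fun y => by fun_prop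

/-- Phases have modulus one. This bound lets `bogU X F` at positive momenta be paired with an
integrable function without knowing that it is square integrable. -/
theorem norm_bogU_le (X : ℝ → ℝ) (F : ℝ → ℂ) (k : ℝ) :
    ‖bogU X F k‖ ≤ 1 / √(2 * Real.pi) * ∫ y, ‖untilde F y‖ := by
  rw [bogU_eq_integral_untilde, norm_mul, Complex.norm_real, Real.norm_of_nonneg (by positivity)]
  gcongr
  refine (norm_integral_le_integral_norm _).trans_eq
    (integral_congr_ae (Filter.Eventually.of_forall fun y => ?_))
  simp only [norm_mul, norm_exp_neg_I_mul_mul, one_mul]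

end CoordinateChange

/-! ### Integrability of wave functions of positive momentum -/

theorem ae_momMeasure_pos : ∀ᵐ k ∂momMeasure, 0 < k :=
  (withDensity_absolutelyContinuous _ _).ae_le (ae_restrict_mem measurableSet_Ioi)

/-- Continuity from the left at the origin. -/
theorem IsPositiveMomentum.apply_zero {G : 𝓢(ℝ, ℂ)} (hG : IsPositiveMomentum G) : G 0 = 0 := by
  have h : Set.EqOn G 0 (closure (Set.Iio 0)) :=
    Set.EqOn.closure (fun p hp => hG p hp) G.continuous continuous_const
  exact h (by simp)

theorem IsPositiveMomentum.exists_norm_le_mul {G : 𝓢(ℝ, ℂ)} (hG : IsPositiveMomentum G) :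
    ∃ C, ∀ k, ‖G k‖ ≤ C * |k| := by
  obtain ⟨C, -, hC⟩ := G.decay 0 1
  refine ⟨C, fun k => ?_⟩
  have := Convex.norm_image_sub_le_of_norm_fderiv_le (𝕜 := ℝ) (f := G) (s := Set.univ) (C := C)
    (x := 0) (y := k) (fun x _ => G.differentiable x)
    (fun x _ => by simpa [norm_iteratedFDeriv_one] using hC x) convex_univ (by simp) (by simp)
  simpa [hG.apply_zero] using this

/-- The singular weight `1/(2k)` is harmless: near zero `G` vanishes linearly, by `G 0 = 0` and a
bounded derivative, and beyond 1 the weight is below 1. -/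
theorem IsPositiveMomentum.integrable {G : 𝓢(ℝ, ℂ)} (hG : IsPositiveMomentum G) :
    Integrable G momMeasure := by
  obtain ⟨C, hC⟩ := hG.exists_norm_le_mul
  have hmeas : Measurable fun k : ℝ => Real.toNNReal (1 / (2 * k)) := by fun_prop
  refine (integrable_withDensity_iff_integrable_smul hmeas).2 ?_
  have hb : IntegrableOn ((Set.Ioc (0 : ℝ) 1).indicator fun _ => C) (Set.Ioi 0) :=
    ((integrable_indicator_iff measurableSet_Ioc).2 (by simp)).integrableOn
  refine (hb.add ((G.integrable (μ := volume)).norm.integrableOn)).mono'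
    ((hmeas.aestronglyMeasurable).smul G.continuous.aestronglyMeasurable) ?_
  filter_upwards [ae_restrict_mem measurableSet_Ioi] with k hk
  have hk : 0 < k := hk
  have hn : ‖Real.toNNReal (1 / (2 * k)) • G k‖ = 1 / (2 * k) * ‖G k‖ := by
    rw [NNReal.smul_def, norm_smul, Real.coe_toNNReal _ (by positivity),
      Real.norm_of_nonneg (by positivity)]
  have hCk := hC k
  rw [abs_of_pos hk] at hCk
  rw [hn, one_div_mul_eq_div, div_le_iff₀ (by positivity), Pi.add_apply]
  by_cases h1 : k ≤ 1
  · rw [Set.indicator_of_mem (show k ∈ Set.Ioc (0 : ℝ) 1 from ⟨hk, h1⟩)]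
    nlinarith [norm_nonneg (G k)]
  · rw [Set.indicator_of_notMem (fun h => h1 h.2)]
    nlinarith [norm_nonneg (G k)]

/-! ### Mean particle numbers -/

/-- The conjugation in the adjoint reverses the sign of momentum, undoing the reversal in the
creation part. -/
theorem oneParticle_untilde (G : 𝓢(ℝ, ℂ)) :
    oneParticle (untilde G) = singleParticle fun q => conj (G q) := by
  rw [oneParticle, inFieldDagger, inField_fockVacuum]
  simp only [fourierTilde_conj, neg_neg, fourierTilde_untilde]

theorem IsNormalized.integrable_norm_sq {G : 𝓢(ℝ, ℂ)} (hG : IsNormalized G) :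
    Integrable (fun q => ‖G q‖ ^ 2) momMeasure := by
  -- A non-integrable function has integral 0 by convention, which contradicts the value 1.
  by_contra h
  rw [IsNormalized, momInner, integral_conj_mul_self, integral_undef h] at hG
  simp at hG

theorem IsNormalized.memLp {G : 𝓢(ℝ, ℂ)} (hG : IsNormalized G) : MemLp G 2 momMeasure :=
  (memLp_two_iff_integrable_sq_norm G.continuous.aestronglyMeasurable).2 hG.integrable_norm_sq

theorem IsNormalized.integral_norm_sq {G : 𝓢(ℝ, ℂ)} (hG : IsNormalized G) :
    ∫ q, ‖G q‖ ^ 2 ∂momMeasure = 1 := by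
  rw [IsNormalized, momInner, integral_conj_mul_self] at hG
  exact_mod_cast hG

/-- The cutoff `θ` is invisible because `momMeasure` lives on positive momenta. -/
theorem momInner_bogA (X : ℝ → ℝ) (F G : ℝ → ℂ) :
    momInner G (bogA X F) = ∫ q, conj (G q) * bogU X F q ∂momMeasure := by
  refine integral_congr_ae ?_
  filter_upwards [ae_momMeasure_pos] with q hq
  simp [bogA, hq]

theorem momInner_bogB (X : ℝ → ℝ) (F G : ℝ → ℂ) :
    momInner G (bogB X F) = ∫ q, conj (G q) * bogU X F (-q) ∂momMeasure := by
  refine integral_congr_ae ?_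
  filter_upwards [ae_momMeasure_pos] with q hq
  simp [bogB, hq]

section MeanNumber

variable {X : ℝ → ℝ} {F G : 𝓢(ℝ, ℂ)}

theorem meanNumber_fockVacuum (hX : Differentiable ℝ X) (hX' : ∀ y, deriv X y ≠ 0) :
    meanNumber X (untilde F) fockVacuum = ∫⁻ q, ‖bogU X F (-q)‖ₑ ^ 2 ∂momMeasure := by
  rw [meanNumber, outField, inField_fockVacuum, fockNormSq_singleParticle]
  simp only [fourierTilde_inTest_untilde hX hX']

theorem meanNumber_oneParticle (hX : Differentiable ℝ X) (hX' : ∀ y, deriv X y ≠ 0)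
    (hGn : IsNormalized G) :
    meanNumber X (untilde F) (oneParticle (untilde G)) =
      meanNumber X (untilde F) fockVacuum
        + ENNReal.ofReal (‖momInner G (bogA X F)‖ ^ 2)
        + ENNReal.ofReal (‖momInner (fun k => conj (G k)) (bogB X F)‖ ^ 2) := by
  have hU : Measurable fun q => bogU X F (-q) :=
    (continuous_bogU hX.continuous F).measurable.comp measurable_neg
  have hG : Measurable fun q => conj (G q) :=
    (Complex.continuous_conj.comp G.continuous).measurable
  rw [meanNumber_fockVacuum hX hX', momInner_bogA, momInner_bogB, meanNumber, outField,
    oneParticle_untilde, fockNormSq_inField_singleParticle]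
  simp only [fourierTilde_inTest_untilde hX hX']
  rw [lintegral_enorm_symmetrized hU hG hGn.memLp.star (by simpa using hGn.integral_norm_sq),
    add_comm (ENNReal.ofReal _), add_right_comm]
  simp only [mul_comm (bogU X F _)]

theorem memLp_bogU_neg (hX : Differentiable ℝ X) (hX' : ∀ y, deriv X y ≠ 0)
    (hfin : meanNumber X (untilde F) fockVacuum ≠ ∞) :
    MemLp (fun q => bogU X F (-q)) 2 momMeasure :=
  memLp_two_of_lintegral_ne_top
    ((continuous_bogU hX.continuous F).comp continuous_neg).aestronglyMeasurable
    (meanNumber_fockVacuum hX hX' ▸ hfin)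

theorem toReal_meanNumber_fockVacuum (hX : Differentiable ℝ X) (hX' : ∀ y, deriv X y ≠ 0)
    (hfin : meanNumber X (untilde F) fockVacuum ≠ ∞) :
    (meanNumber X (untilde F) fockVacuum).toReal = ∫ q, ‖bogU X F (-q)‖ ^ 2 ∂momMeasure := by
  rw [meanNumber_fockVacuum hX hX',
    lintegral_enorm_sq_eq_ofReal (memLp_bogU_neg hX hX' hfin),
    ENNReal.toReal_ofReal (integral_nonneg fun q => by positivity)]

theorem numberElement_fockVacuum (hX : Differentiable ℝ X) (hX' : ∀ y, deriv X y ≠ 0)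
    (hfin : meanNumber X (untilde F) fockVacuum ≠ ∞) :
    numberElement X (untilde F) fockVacuum =
      ((meanNumber X (untilde F) fockVacuum).toReal : ℂ) := by
  rw [toReal_meanNumber_fockVacuum hX hX' hfin, numberElement, fockInner_fockVacuum,
    outFieldDagger, outField, inField_fockVacuum, inFieldDagger, inField_singleParticle_zero]
  simp only [fourierTilde_conj, fourierTilde_inTest_untilde hX hX']
  exact integral_conj_mul_self fun q => bogU X F (-q)

theorem numberElement_oneParticle (hX : Differentiable ℝ X) (hX' : ∀ y, deriv X y ≠ 0)
    (hG : IsPositiveMomentum G) (hGn : IsNormalized G)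
    (hfin : meanNumber X (untilde F) fockVacuum ≠ ∞) :
    numberElement X (untilde F) (oneParticle (untilde G)) =
      ((meanNumber X (untilde F) (oneParticle (untilde G))).toReal : ℂ) := by
  have hu := memLp_bogU_neg hX hX' hfin
  have hGu : Integrable (fun q => G q * bogU X F (-q)) momMeasure := hGn.memLp.integrable_mul hu
  -- Here `G` is integrable and `bogU X F` bounded; finiteness of the vacuum number gives square
  -- integrability only at negative momenta.
  have hGU : Integrable (fun q => conj (G q) * bogU X F q) momMeasure :=
    ((LinearIsometryEquiv.integrable_comp_iff Complex.conjLIE).2 hG.integrable).mul_bdd (c := 1 / √(2 * Real.pi) * ∫ y, ‖untilde F y‖)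
      (continuous_bogU hX.continuous F).aestronglyMeasurable
      (Filter.Eventually.of_forall fun q => norm_bogU_le X F q)
  have hGU' : ∫ q, G q * conj (bogU X F q) ∂momMeasure =
      conj (∫ q, conj (G q) * bogU X F q ∂momMeasure) := by
    rw [← integral_conj]
    simp
  have hGu' : ∫ q, conj (bogU X F (-q)) * conj (G q) ∂momMeasure =
      conj (∫ q, G q * bogU X F (-q) ∂momMeasure) := by
    rw [← integral_conj]
    simp [mul_comm]
  have huu : Integrable (fun q => conj (bogU X F (-q)) * bogU X F (-q)) momMeasure :=
    hu.integrable_conj_mul hu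
  have huG : Integrable (fun q => conj (bogU X F (-q)) * conj (G q)) momMeasure :=
    hu.integrable_conj_mul hGn.memLp.star
  -- Pairing these three terms with `conj G` gives, in turn, the vacuum number, the `bogB` term and
  -- the `bogA` term.
  have hone : ∀ q, inFieldDagger (inTest X (untilde F))
      (inField (inTest X (untilde F)) (singleParticle fun q => conj (G q))) 1 (fun _ => q) =
      ((meanNumber X (untilde F) fockVacuum).toReal : ℂ) * conj (G q)
        + bogU X F (-q) * conj (∫ r, G r * bogU X F (-r) ∂momMeasure)
        + conj (bogU X F q) * ∫ r, conj (G r) * bogU X F r ∂momMeasure := by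
    intro q
    rw [inFieldDagger_inField_singleParticle_one]
    simp only [fourierTilde_inTest_untilde hX hX']
    have e : ∀ r, conj (bogU X F (-r)) *
        (bogU X F (-r) * conj (G q) + bogU X F (-q) * conj (G r)) =
        conj (bogU X F (-r)) * bogU X F (-r) * conj (G q) +
          bogU X F (-q) * (conj (bogU X F (-r)) * conj (G r)) := fun r => by ring
    simp only [e]
    rw [integral_add (huu.mul_const _) (huG.const_mul _), integral_mul_const, integral_const_mul,
      integral_conj_mul_self fun q => bogU X F (-q), hGu',
      toReal_meanNumber_fockVacuum hX hX' hfin]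
    simp only [mul_comm (bogU X F _) (conj (G _))]
  rw [meanNumber_oneParticle hX hX' hGn, momInner_bogA, momInner_bogB,
    ENNReal.toReal_add (by simpa using hfin) (by simp), ENNReal.toReal_add hfin (by simp),
    ENNReal.toReal_ofReal (by positivity), ENNReal.toReal_ofReal (by positivity), numberElement,
    oneParticle_untilde, fockInner_singleParticle, outFieldDagger, outField]
  simp only [hone, Complex.conj_conj]
  set N : ℂ := ((meanNumber X (untilde F) fockVacuum).toReal : ℂ)
  set a := ∫ r, conj (G r) * bogU X F r ∂momMeasure
  set b := ∫ r, G r * bogU X F (-r) ∂momMeasure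
  have e : ∀ q, G q * (N * conj (G q) + bogU X F (-q) * conj b + conj (bogU X F q) * a) =
      N * (conj (G q) * G q) + G q * bogU X F (-q) * conj b + G q * conj (bogU X F q) * a :=
    fun q => by ring
  have hGU'' : Integrable (fun q => G q * conj (bogU X F q)) momMeasure := by
    simpa using (LinearIsometryEquiv.integrable_comp_iff Complex.conjLIE).2 hGU
  simp only [e]
  refine (integral_add (((hGn.memLp.integrable_conj_mul hGn.memLp).const_mul N).add
    (hGu.mul_const (conj b))) (hGU''.mul_const a)).trans ?_
  simp only [Pi.add_apply]
  rw [integral_add ((hGn.memLp.integrable_conj_mul hGn.memLp).const_mul N) (hGu.mul_const _),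
    integral_const_mul, integral_mul_const, integral_mul_const, hGU', integral_conj_mul_self,
    hGn.integral_norm_sq, Complex.mul_conj', Complex.conj_mul']
  push_cast
  ring

end MeanNumber

theorem mainTheorem5 (X : ℝ → ℝ) (hX : ContDiff ℝ 1 X) (hX' : ∀ y, deriv X y ≠ 0)
    (F G : 𝓢(ℝ, ℂ)) (hF : IsPositiveMomentum F) (hG : IsPositiveMomentum G)
    (hFn : IsNormalized F) (hGn : IsNormalized G) :
    meanNumber X (untilde F) (oneParticle (untilde G)) =
        meanNumber X (untilde F) fockVacuum
          + ENNReal.ofReal (‖momInner G (bogA X F)‖ ^ 2)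
          + ENNReal.ofReal (‖momInner (fun k => conj (G k)) (bogB X F)‖ ^ 2) ∧
      (meanNumber X (untilde F) fockVacuum ≠ ∞ →
        numberElement X (untilde F) fockVacuum =
            ((meanNumber X (untilde F) fockVacuum).toReal : ℂ) ∧
          numberElement X (untilde F) (oneParticle (untilde G)) =
            ((meanNumber X (untilde F) (oneParticle (untilde G))).toReal : ℂ)) := by
  have hd : Differentiable ℝ X := hX.differentiable one_ne_zero
  exact ⟨meanNumber_oneParticle hd hX' hGn, fun hfin =>
    ⟨numberElement_fockVacuum hd hX' hfin, numberElement_oneParticle hd hX' hG hGn hfin⟩⟩
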